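/- All graphs $G$ are simple; a connected graph is regarded as a geodesic metric space in which every edge is a copy of $[0,1]$, with $d_G$ the length distance, and points in different connected components of a graph have distance $\infty$. A geodesic metric space is hyperbolic if there is $\delta\ge 0$ such that each side of every geodesic triangle is contained in the $\delta$-neighbourhood of the union of the other two sides; a graph with several components is hyperbolic if its components satisfy this with a common $\delta$. A graph is bounded if its diameter is finite, and non-trivial if it has more than one vertex. The direct product $G_1\times G_2$ has vertex set $V(G_1)\times V(G_2)$, with $(u_1,v_1)$ and $(u_2,v_2)$ adjacent if $u_1u_2\in E(G_1)$ and $v_1v_2\in E(G_2)$. Let $C$ be a (simple) cycle of a graph $G$. A $u,v$-walk $g$ in $G$ is a shortcut of $C$ if $g\cap C=\{u,v\}$ and $L(g)<d_C(u,v)$, where $d_C$ is the length metric of $C$. A cycle $C'$ is a reduction of $C$ if $C$ and $C'$ both have odd length and $C'$ is the union of a subarc $\eta$ of $C$ and a shortcut of $C$ joining the endpoints of $\eta$. A cycle is minimal if it has odd length and has no reduction. Let $\mathfrak{C}(G)$ be the set of minimal cycles of $G$, and let $d_G(w,\mathfrak{C}(G))$ be the infimum of the distances from $w$ to points of minimal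 cycles ($\infty$ if there are none). Theorem. Let $G_1$ be a connected hyperbolic graph and $G_2$ a connected, non-trivial, bounded graph. If there is a constant $K>0$ such that $d_{G_1}(w,\mathfrak{C}(G_1))\le K$ for every vertex $w$ of $G_1$, then $G_1\times G_2$ is hyperbolic. -/

import Mathlib

open scoped ENNReal NNReal

/-! ### Geodesics and Gromov hyperbolicity (Rips condition)

Distances may be infinite, so that spaces with several connected components are covered. -/

/-- `S` is (the image of) a geodesic from `x` to `y`, parametrized by arc length. -/
def IsGeodesicSegment {X : Type*} [PseudoEMetricSpace X] (x y : X) (S : Set X) : Prop :=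
  ∃ (ℓ : ℝ) (γ : ℝ → X), 0 ≤ ℓ ∧ γ 0 = x ∧ γ ℓ = y ∧
    (∀ s ∈ Set.Icc 0 ℓ, ∀ t ∈ Set.Icc 0 ℓ, edist (γ s) (γ t) = ENNReal.ofReal |s - t|) ∧
    S = γ '' Set.Icc 0 ℓ

/-- Each side of every geodesic triangle is contained in the `δ`-neighbourhood of the union of the
two other sides. (Since the three vertices are arbitrary, it is enough to name one side.)
The sides of a geodesic triangle lie at finite distance from each other, hence in a single
connected component, so that on a disconnected space this says that every component is
`δ`-hyperbolic. -/
def IsDeltaHyperbolic (X : Type*) [PseudoEMetricSpace X] (δ : ℝ≥0) : Prop :=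
  ∀ (x y z : X) (S₁ S₂ S₃ : Set X),
    IsGeodesicSegment x y S₁ → IsGeodesicSegment y z S₂ → IsGeodesicSegment z x S₃ →
      ∀ p ∈ S₁, Metric.infEDist p (S₂ ∪ S₃) ≤ δ

/-- Gromov hyperbolicity. On a space with several components the constant is uniform over them. -/
def IsGromovHyperbolic (X : Type*) [PseudoEMetricSpace X] : Prop :=
  ∃ δ : ℝ≥0, IsDeltaHyperbolic X δ

/-! ### The metric graph of a simple graph -/

/-- The points of the metric graph of `G`, every edge being a copy of `[0, 1]`, in barycentric
coordinates: a point is a vertex, or it lies on an edge `uv` and is given by the weights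
`x u + x v = 1` of the two endpoints. -/
@[ext]
structure MetricGraph {V : Type*} (G : SimpleGraph V) where
  weight : V → ℝ
  nonneg : ∀ w, 0 ≤ weight w
  carried : (∃ u, weight u = 1 ∧ ∀ w, w ≠ u → weight w = 0) ∨
    ∃ u v, G.Adj u v ∧ weight u + weight v = 1 ∧ ∀ w, w ≠ u → w ≠ v → weight w = 0

namespace MetricGraph

variable {V : Type*} {G : SimpleGraph V}

/-- The point of the metric graph given by a vertex. -/
noncomputable def vertex (G : SimpleGraph V) (v : V) : MetricGraph G where
  weight := Set.indicator {v} 1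
  nonneg w := Set.indicator_nonneg (fun _ _ => zero_le_one) w
  carried := Or.inl ⟨v, by simp, fun w hw => by simp [hw]⟩

/-- `x` lies on the closed edge with endpoints `u` and `v`. -/
def OnEdge (x : MetricGraph G) (u v : V) : Prop :=
  G.Adj u v ∧ ∀ w, w ≠ u → w ≠ v → x.weight w = 0

/-- The lengths of the direct paths from `x` to `y`: either leave `x` along its edge to an
endpoint `u` (at distance `1 - x u`), walk to a vertex `v` of the edge of `y`, and continue to `y`
(at distance `1 - y v` from `v`); or, if `x` and `y` lie on a common edge, stay on that edge. -/
def pathLengths (x y : MetricGraph G) : Set ℝ≥0∞ :=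
  {r | (∃ u v, x.weight u ≠ 0 ∧ y.weight v ≠ 0 ∧
        r = ENNReal.ofReal (1 - x.weight u) + (G.edist u v : ℝ≥0∞)
          + ENNReal.ofReal (1 - y.weight v)) ∨
      ∃ u v, x.OnEdge u v ∧ y.OnEdge u v ∧ r = ENNReal.ofReal |x.weight u - y.weight u|}

/-- The length distance; it is `∞` between different components. -/
noncomputable instance : EDist (MetricGraph G) := ⟨fun x y => sInf (pathLengths x y)⟩

theorem edist_def (x y : MetricGraph G) : edist x y = sInf (pathLengths x y) := rfl

theorem OnEdge.symm {x : MetricGraph G} {u v : V} (h : x.OnEdge u v) : x.OnEdge v u :=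
  ⟨h.1.symm, fun w h1 h2 => h.2 w h2 h1⟩

theorem OnEdge.add_eq {x : MetricGraph G} {u v : V} (h : x.OnEdge u v) :
    x.weight u + x.weight v = 1 := by
  have huv := h.1.ne
  have h2 := h.2
  rcases x.carried with ⟨a, ha, ha'⟩ | ⟨a, b, hab, hs, ha'⟩
  · rcases eq_or_ne a u with rfl | hau
    · rw [ha, ha' v huv.symm, add_zero]
    · rcases eq_or_ne a v with rfl | hav
      · rw [ha, ha' u huv, zero_add]
      · have := h2 a hau hav
        linarith
  · have hne := hab.ne
    rcases eq_or_ne a u with rfl | hau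
    · rcases eq_or_ne b v with rfl | hbv
      · exact hs
      · rw [ha' v huv.symm hbv.symm]
        rw [h2 b hne.symm hbv] at hs
        exact hs
    · rcases eq_or_ne a v with rfl | hav
      · rcases eq_or_ne b u with rfl | hbu
        · rw [add_comm]; exact hs
        · rw [ha' u hau.symm hbu.symm]
          rw [h2 b hbu hne.symm] at hs
          linarith
      · rw [h2 a hau hav, zero_add] at hs
        rcases eq_or_ne b u with rfl | hbu
        · rw [ha' v hav.symm huv.symm]
          linarith
        · rcases eq_or_ne b v with rfl | hbv
          · rw [ha' u hau.symm hbu.symm]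
            linarith
          · have := h2 b hbu hbv
            linarith

theorem OnEdge.mem {x : MetricGraph G} {u v w : V} (h : x.OnEdge u v) (hw : x.weight w ≠ 0) :
    w = u ∨ w = v := by
  by_contra! hc
  exact hw (h.2 w hc.1 hc.2)

theorem exists_ne_zero (x : MetricGraph G) : ∃ u, x.weight u ≠ 0 := by
  rcases x.carried with ⟨a, ha, -⟩ | ⟨a, b, -, hs, -⟩
  · exact ⟨a, by rw [ha]; exact one_ne_zero⟩
  · by_contra! hc
    rw [hc a, hc b] at hs
    norm_num at hs

theorem weight_le_one (x : MetricGraph G) (w : V) : x.weight w ≤ 1 := by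
  rcases x.carried with ⟨a, ha, ha'⟩ | ⟨a, b, -, hs, ha'⟩
  · rcases eq_or_ne w a with rfl | h
    · exact ha.le
    · rw [ha' w h]; exact zero_le_one
  · have h1 := x.nonneg a
    have h2 := x.nonneg b
    rcases eq_or_ne w a with rfl | h
    · linarith
    · rcases eq_or_ne w b with rfl | h'
      · linarith
      · rw [ha' w h h']; exact zero_le_one

/-- Two different vertices that carry `x` are the endpoints of an edge containing `x`. -/
theorem onEdge_of_ne {x : MetricGraph G} {u v : V} (hu : x.weight u ≠ 0) (hv : x.weight v ≠ 0)
    (huv : u ≠ v) : x.OnEdge u v := by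
  rcases x.carried with ⟨a, -, ha'⟩ | ⟨a, b, hab, -, ha'⟩
  · have h1 : u = a := by by_contra h; exact hu (ha' u h)
    have h2 : v = a := by by_contra h; exact hv (ha' v h)
    exact absurd (h1.trans h2.symm) huv
  · have hx : x.OnEdge a b := ⟨hab, ha'⟩
    rcases hx.mem hu with rfl | rfl <;> rcases hx.mem hv with rfl | rfl
    · exact absurd rfl huv
    · exact hx
    · exact hx.symm
    · exact absurd rfl huv

theorem adj_edist_le {u v : V} (h : G.Adj u v) : (G.edist u v : ℝ≥0∞) ≤ 1 := by
  have : G.edist u v ≤ 1 := by simpa using G.edist_le h.toWalk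
  simpa using ENat.toENNReal_le.2 this

theorem coe_edist_triangle (u v w : V) :
    (G.edist u w : ℝ≥0∞) ≤ (G.edist u v : ℝ≥0∞) + (G.edist v w : ℝ≥0∞) := by
  rw [← ENat.toENNReal_add]
  exact ENat.toENNReal_le.2 G.edist_triangle

theorem near_aux {x : MetricGraph G} {u : V} (hu : x.weight u ≠ 0 ∨ ∃ u', x.OnEdge u u') (v : V) :
    ∃ w, x.weight w ≠ 0 ∧ ENNReal.ofReal (1 - x.weight w) + (G.edist w v : ℝ≥0∞)
      ≤ ENNReal.ofReal (1 - x.weight u) + (G.edist u v : ℝ≥0∞) := by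
  by_cases h : x.weight u = 0
  · obtain ⟨u', hu'⟩ := hu.resolve_left (fun h' => h' h)
    have h1 : x.weight u' = 1 := by have := hu'.add_eq; linarith
    refine ⟨u', by rw [h1]; exact one_ne_zero, ?_⟩
    rw [h1, h]
    simp only [sub_self, ENNReal.ofReal_zero, zero_add, sub_zero, ENNReal.ofReal_one]
    refine (coe_edist_triangle u' u v).trans ?_
    gcongr
    exact adj_edist_le hu'.1.symm
  · exact ⟨u, h, le_rfl⟩

theorem edist_le_of_near {x y : MetricGraph G} {u v : V}
    (hu : x.weight u ≠ 0 ∨ ∃ u', x.OnEdge u u') (hv : y.weight v ≠ 0 ∨ ∃ v', y.OnEdge v v') :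
    edist x y ≤ ENNReal.ofReal (1 - x.weight u) + (G.edist u v : ℝ≥0∞)
      + ENNReal.ofReal (1 - y.weight v) := by
  obtain ⟨a, ha, ha'⟩ := near_aux hu v
  obtain ⟨b, hb, hb'⟩ := near_aux hv a
  calc edist x y ≤ ENNReal.ofReal (1 - x.weight a) + (G.edist a b : ℝ≥0∞)
        + ENNReal.ofReal (1 - y.weight b) := sInf_le (Or.inl ⟨a, b, ha, hb, rfl⟩)
    _ = ENNReal.ofReal (1 - x.weight a) + (ENNReal.ofReal (1 - y.weight b)
        + (G.edist b a : ℝ≥0∞)) := by rw [G.edist_comm (u := a)]; ring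
    _ ≤ ENNReal.ofReal (1 - x.weight a) + (ENNReal.ofReal (1 - y.weight v)
        + (G.edist v a : ℝ≥0∞)) := by gcongr
    _ = (ENNReal.ofReal (1 - x.weight a) + (G.edist a v : ℝ≥0∞))
        + ENNReal.ofReal (1 - y.weight v) := by rw [G.edist_comm (u := v)]; ring
    _ ≤ _ := by gcongr

theorem edist_le_of_onEdge {x y : MetricGraph G} {u v : V} (hx : x.OnEdge u v)
    (hy : y.OnEdge u v) : edist x y ≤ ENNReal.ofReal |x.weight u - y.weight u| :=
  sInf_le (Or.inr ⟨u, v, hx, hy, rfl⟩)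

theorem abs_sub_eq {x y : MetricGraph G} {u v : V} (hx : x.OnEdge u v) (hy : y.OnEdge u v) :
    |x.weight u - y.weight u| = |x.weight v - y.weight v| := by
  have h1 := hx.add_eq
  have h2 := hy.add_eq
  rw [show x.weight u - y.weight u = -(x.weight v - y.weight v) by linarith, abs_neg]

theorem pathLengths_comm_le {x y : MetricGraph G} {r : ℝ≥0∞} (h : r ∈ pathLengths x y) :
    r ∈ pathLengths y x := by
  rcases h with ⟨u, v, hu, hv, rfl⟩ | ⟨u, v, hx, hy, rfl⟩
  · exact Or.inl ⟨v, u, hv, hu, by rw [G.edist_comm (u := u)]; ring⟩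
  · exact Or.inr ⟨u, v, hy, hx, by rw [abs_sub_comm]⟩

theorem straight_route {x y z : MetricGraph G} {a b v w : V} (hx : x.OnEdge a b)
    (hy : y.OnEdge a b) (hv : y.weight v ≠ 0) (hw : z.weight w ≠ 0) :
    edist x z ≤ ENNReal.ofReal |x.weight a - y.weight a| + (ENNReal.ofReal (1 - y.weight v)
      + (G.edist v w : ℝ≥0∞) + ENNReal.ofReal (1 - z.weight w)) := by
  have key : (∃ v', x.OnEdge v v') ∧
      |x.weight a - y.weight a| = |x.weight v - y.weight v| := by
    rcases hy.mem hv with rfl | rfl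
    · exact ⟨⟨_, hx⟩, rfl⟩
    · exact ⟨⟨_, hx.symm⟩, abs_sub_eq hx hy⟩
  refine (edist_le_of_near (Or.inr key.1) (Or.inl hw)).trans ?_
  rw [← add_assoc, ← add_assoc]
  gcongr
  rw [key.2, ← ENNReal.ofReal_add (abs_nonneg _) (by linarith [y.weight_le_one v])]
  refine ENNReal.ofReal_le_ofReal ?_
  have := neg_abs_le (x.weight v - y.weight v)
  linarith

theorem straight_straight {x y z : MetricGraph G} {a b c d : V} (hx : x.OnEdge a b)
    (hy : y.OnEdge a b) (hy' : y.OnEdge c d) (hz : z.OnEdge c d) :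
    edist x z ≤ ENNReal.ofReal |x.weight a - y.weight a|
      + ENNReal.ofReal |y.weight c - z.weight c| := by
  by_cases hab : z.OnEdge a b
  · have hc : |y.weight c - z.weight c| = |y.weight a - z.weight a| := by
      have h1 : c = a ∨ d = a ∨ z.weight a = 0 ∧ y.weight a = 0 := by
        by_contra! h
        rcases eq_or_ne (z.weight a) 0 with h0 | h0
        · exact h.2.2 h0 (hy'.2 a h.1.symm h.2.1.symm)
        · exact h0 (hz.2 a h.1.symm h.2.1.symm)
      rcases h1 with rfl | rfl | ⟨h1, h2⟩
      · rfl
      · exact abs_sub_eq hy' hz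
      · have hb1 : y.weight b = 1 := by have := hy.add_eq; linarith
        have hb2 : z.weight b = 1 := by have := hab.add_eq; linarith
        rcases hy'.mem (w := b) (by rw [hb1]; exact one_ne_zero) with rfl | rfl
        · rw [h1, h2, hb1, hb2]; simp
        · rw [abs_sub_eq hy' hz, h1, h2, hb1, hb2]; simp
    rw [hc, ← ENNReal.ofReal_add (abs_nonneg _) (abs_nonneg _)]
    exact (edist_le_of_onEdge hx hab).trans (ENNReal.ofReal_le_ofReal (abs_sub_le _ _ _))
  · have hone : ∃ v, y.weight v = 1 := by
      obtain ⟨v, hv⟩ := y.exists_ne_zero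
      by_contra! hc
      have hy0 : ∀ {p q : V}, y.OnEdge p q → y.weight p ≠ 0 := fun {p q} h h0 =>
        hc q (by have := h.add_eq; linarith)
      rcases hy'.mem (hy0 hy) with rfl | rfl <;> rcases hy'.mem (hy0 hy.symm) with rfl | rfl
      · exact hy.1.ne rfl
      · exact hab hz
      · exact hab hz.symm
      · exact hy.1.ne rfl
    obtain ⟨v, hv⟩ := hone
    have hv0 : y.weight v ≠ 0 := by rw [hv]; exact one_ne_zero
    have key : ∀ {p q : V} {t : MetricGraph G}, t.OnEdge p q → y.OnEdge p q →
        (∃ v', t.OnEdge v v') ∧ |t.weight p - y.weight p| = 1 - t.weight v := by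
      intro p q t ht hyt
      have : |t.weight v - y.weight v| = 1 - t.weight v := by
        rw [hv, abs_sub_comm, abs_of_nonneg (by linarith [t.weight_le_one v])]
      rcases hyt.mem hv0 with rfl | rfl
      · exact ⟨⟨_, ht⟩, this⟩
      · exact ⟨⟨_, ht.symm⟩, (abs_sub_eq ht hyt).trans this⟩
    have k1 := key hx hy
    have k2 := key hz hy'
    refine (edist_le_of_near (Or.inr k1.1) (Or.inr k2.1)).trans ?_
    rw [k1.2, abs_sub_comm, k2.2]
    simp

theorem route_route {x y z : MetricGraph G} {u v v' w : V} (hu : x.weight u ≠ 0)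
    (hv : y.weight v ≠ 0) (hv' : y.weight v' ≠ 0) (hw : z.weight w ≠ 0) :
    edist x z ≤ (ENNReal.ofReal (1 - x.weight u) + (G.edist u v : ℝ≥0∞)
        + ENNReal.ofReal (1 - y.weight v)) + (ENNReal.ofReal (1 - y.weight v')
        + (G.edist v' w : ℝ≥0∞) + ENNReal.ofReal (1 - z.weight w)) := by
  have key : (G.edist v v' : ℝ≥0∞)
      ≤ ENNReal.ofReal (1 - y.weight v) + ENNReal.ofReal (1 - y.weight v') := by
    rcases eq_or_ne v v' with rfl | hne
    · simp
    · have h := onEdge_of_ne hv hv' hne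
      rw [← ENNReal.ofReal_add (by linarith [y.weight_le_one v])
        (by linarith [y.weight_le_one v']),
        show 1 - y.weight v + (1 - y.weight v') = 1 by have := h.add_eq; linarith,
        ENNReal.ofReal_one]
      exact adj_edist_le h.1
  refine (edist_le_of_near (Or.inl hu) (Or.inl hw)).trans ?_
  calc ENNReal.ofReal (1 - x.weight u) + (G.edist u w : ℝ≥0∞) + ENNReal.ofReal (1 - z.weight w)
      ≤ ENNReal.ofReal (1 - x.weight u) + ((G.edist u v : ℝ≥0∞)
        + ((ENNReal.ofReal (1 - y.weight v) + ENNReal.ofReal (1 - y.weight v'))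
        + (G.edist v' w : ℝ≥0∞))) + ENNReal.ofReal (1 - z.weight w) := by
        gcongr
        refine (coe_edist_triangle u v w).trans ?_
        gcongr
        refine (coe_edist_triangle v v' w).trans ?_
        gcongr
    _ = _ := by ring

noncomputable instance : PseudoEMetricSpace (MetricGraph G) where
  edist_self x := by
    obtain ⟨u, hu⟩ := x.exists_ne_zero
    rcases x.carried with ⟨a, ha, -⟩ | ⟨a, b, hab, -, hx⟩
    · have h0 : x.weight a ≠ 0 := by rw [ha]; exact one_ne_zero
      have := edist_le_of_near (x := x) (y := x) (Or.inl h0) (Or.inl h0)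
      simpa [ha] using this
    · simpa using edist_le_of_onEdge (x := x) (y := x) ⟨hab, hx⟩ ⟨hab, hx⟩
  edist_comm x y := by
    rw [edist_def, edist_def]
    exact congrArg sInf (Set.ext fun r => ⟨pathLengths_comm_le, pathLengths_comm_le⟩)
  edist_triangle x y z := by
    rw [edist_def x y, edist_def y z, ENNReal.sInf_add]
    refine le_iInf₂ fun r hr => ?_
    rw [add_comm, ENNReal.sInf_add]
    refine le_iInf₂ fun s hs => ?_
    rw [add_comm]
    rcases hr with ⟨u, v, hu, hv, rfl⟩ | ⟨a, b, hx, hy, rfl⟩ <;>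
      rcases hs with ⟨v', w, hv', hw, rfl⟩ | ⟨c, d, hy', hz, rfl⟩
    · exact route_route hu hv hv' hw
    · have h := straight_route (z := x) hz hy' hv hu
      rw [edist_def, show pathLengths x z = pathLengths z x from
        Set.ext fun r => ⟨pathLengths_comm_le, pathLengths_comm_le⟩, ← edist_def]
      refine h.trans (le_of_eq ?_)
      rw [abs_sub_comm, G.edist_comm (u := v)]
      ring
    · exact straight_route hx hy hv' hw
    · exact straight_straight hx hy hy' hz

end MetricGraph

namespace SimpleGraph

variable {V W : Type*}

/-- The set of points of the metric graph of `G` that lie on a subgraph `H`. -/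
def Subgraph.points {G : SimpleGraph V} (H : G.Subgraph) : Set (MetricGraph G) :=
  {x | (∃ v ∈ H.verts, x = MetricGraph.vertex G v) ∨ ∃ u v, H.Adj u v ∧ x.OnEdge u v}

/-! ### Hyperbolic and bounded graphs -/

/-- `G` is hyperbolic as a metric graph. -/
def IsHyperbolic (G : SimpleGraph V) : Prop := IsGromovHyperbolic (MetricGraph G)

/-- `G` has finite diameter as a metric graph. -/
def IsBoundedGraph (G : SimpleGraph V) : Prop :=
  Metric.ediam (Set.univ : Set (MetricGraph G)) < ∞

/-! ### Minimal odd cycles -/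

/-- A `u`,`v`-walk `g` is a shortcut of the cycle `C` if `g ∩ C = {u, v}` (as sets of points of
the metric graph: only the vertices `u`, `v` and no edge in common) and the length of `g` is smaller
than the distance of `u` and `v` inside `C`. -/
def IsShortcut {G : SimpleGraph V} {a u v : V} (g : G.Walk u v) (C : G.Walk a a) : Prop :=
  g.toSubgraph.verts ∩ C.toSubgraph.verts = {u, v} ∧
  g.toSubgraph.edgeSet ∩ C.toSubgraph.edgeSet = ∅ ∧
  g.length < C.toSubgraph.spanningCoe.dist u v

/-- The cycle `C'` is a reduction of the cycle `C`: both have odd length and `C'` is the union of a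
subarc `η` of `C` and a shortcut `g` of `C` joining the endpoints of `η`. -/
def IsReduction {G : SimpleGraph V} {a b : V} (C' : G.Walk b b) (C : G.Walk a a) : Prop :=
  Odd C'.length ∧ Odd C.length ∧
  ∃ (u v : V) (η g : G.Walk u v), η.IsPath ∧ η.toSubgraph ≤ C.toSubgraph ∧
    IsShortcut g C ∧ C'.toSubgraph = η.toSubgraph ⊔ g.toSubgraph

/-- A minimal cycle: a cycle of odd length that has no reduction. -/
def IsMinimalCycle {G : SimpleGraph V} {a : V} (C : G.Walk a a) : Prop :=
  C.IsCycle ∧ Odd C.length ∧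
  ∀ (b : V) (C' : G.Walk b b), C'.IsCycle → ¬ IsReduction C' C

/-- The set of points of `G` that lie on some minimal cycle. -/
def minimalCyclePoints (G : SimpleGraph V) : Set (MetricGraph G) :=
  {x | ∃ (a : V) (C : G.Walk a a), IsMinimalCycle C ∧ x ∈ C.toSubgraph.points}

/-! ### The direct product -/

/-- The direct (tensor, categorical) product of two graphs. -/
def directProduct (G : SimpleGraph V) (H : SimpleGraph W) : SimpleGraph (V × W) where
  Adj x y := G.Adj x.1 y.1 ∧ H.Adj x.2 y.2
  symm := ⟨fun _ _ h => ⟨h.1.symm, h.2.symm⟩⟩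
  loopless := ⟨fun _ h => G.irrefl h.1⟩

end SimpleGraph

/-! The projection of the direct product to `G₁` changes distances by at most an additive constant.
It never increases them. Conversely, two walks in the factors combine into a walk in the product as
soon as their lengths have the same parity, since the shorter can be padded by running back and
forth along an edge. Parity is the only obstruction, and an odd closed walk of bounded length at the
starting vertex of `G₁` removes it; the bounded factor adds at most its diameter.

Such odd walks come from the minimal cycles. A shortest path undercutting a minimal cycle would
close up with one of the two arcs to an odd cycle, hence a reduction, so minimal cycles are
isometrically embedded (`IsMinimalCycle.spanningCoe_dist_le`). In a hyperbolic graph an isometric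
cycle has bounded length (`IsMinimalCycle.length_le`), and by assumption one lies within `K` of
every vertex.

Hyperbolicity is carried across by the four-point condition on vertices, which is stable under
additive errors (`FourPointCondition.of_abs_sub_le`). It follows from thin triangles
(`IsHyperbolic.exists_fourPointCondition`) and implies them again
(`IsHyperbolic.of_fourPointCondition`). -/

/-! ### The four-point condition implies thin triangles -/

/-- The four-point condition of Gromov for a distance function, with constant `c`. -/
def FourPointCondition {X : Type*} (d : X → X → ℝ) (c : ℝ) : Prop :=
  ∀ x y z w, d x y + d z w ≤ max (d x z + d y w) (d x w + d y z) + c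

/-- Four distances enter any one comparison, two on each side, each with error `e`. Nothing is asked
of `f` beyond the distance estimate, so it may be a projection or a choice of nearby vertices. -/
theorem FourPointCondition.of_abs_sub_le {X Y : Type*} {d : X → X → ℝ} {d' : Y → Y → ℝ} {c e : ℝ}
    (h : FourPointCondition d c) (f : Y → X) (hf : ∀ x y, |d' x y - d (f x) (f y)| ≤ e) :
    FourPointCondition d' (c + 4 * e) := by
  intro x y z w
  have h1 := abs_le.1 (hf x y)
  have h2 := abs_le.1 (hf z w)
  have h3 := abs_le.1 (hf x z)
  have h4 := abs_le.1 (hf y w)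
  have h5 := abs_le.1 (hf x w)
  have h6 := abs_le.1 (hf y z)
  rcases le_total (d (f x) (f z) + d (f y) (f w)) (d (f x) (f w) + d (f y) (f z)) with hm | hm
  · have := h (f x) (f y) (f z) (f w)
    rw [max_eq_right hm] at this
    linarith [le_max_right (d' x z + d' y w) (d' x w + d' y z)]
  · have := h (f x) (f y) (f z) (f w)
    rw [max_eq_left hm] at this
    linarith [le_max_left (d' x z + d' y w) (d' x w + d' y z)]

theorem IsGeodesicSegment.symm {X : Type*} [PseudoEMetricSpace X] {x y : X} {S : Set X}
    (h : IsGeodesicSegment x y S) : IsGeodesicSegment y x S := by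
  obtain ⟨l, γ, hl, h0, h1, hd, rfl⟩ := h
  refine ⟨l, fun t => γ (l - t), hl, by simpa using h1, by simpa using h0, ?_, ?_⟩
  · intro s hs t ht
    rw [hd _ ⟨by linarith [hs.2], by linarith [hs.1]⟩ _ ⟨by linarith [ht.2], by linarith [ht.1]⟩,
      abs_sub_comm s t]
    congr 2
    ring
  · ext p
    constructor
    · rintro ⟨t, ht, rfl⟩
      exact ⟨l - t, ⟨by linarith [ht.2], by linarith [ht.1]⟩, by simp⟩
    · rintro ⟨t, ht, rfl⟩
      exact ⟨l - t, ⟨by linarith [ht.2], by linarith [ht.1]⟩, rfl⟩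

section PseudoMetric

variable {X : Type*} [PseudoMetricSpace X]

theorem IsGeodesicSegment.dist_add_dist {x y p : X} {S : Set X} (h : IsGeodesicSegment x y S)
    (hp : p ∈ S) : dist x p + dist p y = dist x y := by
  obtain ⟨l, γ, hl, rfl, rfl, hd, rfl⟩ := h
  obtain ⟨t, ht, rfl⟩ := hp
  have key : ∀ s ∈ Set.Icc 0 l, ∀ t ∈ Set.Icc 0 l, dist (γ s) (γ t) = |s - t| := by
    intro s hs t ht
    rw [dist_edist, hd s hs t ht, ENNReal.toReal_ofReal (abs_nonneg _)]
  have h0 : (0 : ℝ) ∈ Set.Icc 0 l := ⟨le_rfl, hl⟩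
  have h1 : l ∈ Set.Icc 0 l := ⟨hl, le_rfl⟩
  rw [key _ h0 _ ht, key _ ht _ h1, key _ h0 _ h1, abs_of_nonpos (by linarith [ht.1]),
    abs_of_nonpos (by linarith [ht.2]), abs_of_nonpos (by linarith)]
  ring

theorem IsGeodesicSegment.exists_dist_eq {x y : X} {S : Set X} (h : IsGeodesicSegment x y S)
    {r : ℝ} (hr : 0 ≤ r) (hr' : r ≤ dist x y) : ∃ q ∈ S, dist x q = r := by
  obtain ⟨l, γ, hl, rfl, rfl, hd, rfl⟩ := h
  have h0 : (0 : ℝ) ∈ Set.Icc 0 l := ⟨le_rfl, hl⟩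
  have h1 : l ∈ Set.Icc 0 l := ⟨hl, le_rfl⟩
  have hl' : dist (γ 0) (γ l) = l := by
    rw [dist_edist, hd _ h0 _ h1, ENNReal.toReal_ofReal (abs_nonneg _), abs_sub_comm, sub_zero,
      abs_of_nonneg hl]
  rw [hl'] at hr'
  refine ⟨γ r, ⟨r, ⟨hr, hr'⟩, rfl⟩, ?_⟩
  rw [dist_edist, hd _ h0 _ ⟨hr, hr'⟩, ENNReal.toReal_ofReal (abs_nonneg _), abs_sub_comm,
    sub_zero, abs_of_nonneg hr]

theorem IsGeodesicSegment.right_mem {x y : X} {S : Set X} (h : IsGeodesicSegment x y S) :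
    y ∈ S := by
  obtain ⟨l, γ, hl, rfl, rfl, hd, rfl⟩ := h
  exact ⟨l, ⟨hl, le_rfl⟩, rfl⟩

/-- A point with small excess over a geodesic is close to it: take `q` on the geodesic at the same
distance from `x` as `p`, and apply the condition to `p, q, x, z`. If `p` is too far from `x` for
that, the endpoint `z` is within `e`. -/
theorem FourPointCondition.exists_dist_le {c : ℝ} (hc : FourPointCondition (dist : X → X → ℝ) c)
    {x z p : X} {S : Set X} (hS : IsGeodesicSegment x z S) {e : ℝ}
    (h : dist x p + dist p z ≤ dist x z + e) (h0 : 0 ≤ c) (he : 0 ≤ e) :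
    ∃ q ∈ S, dist p q ≤ c + e := by
  rcases le_total (dist x p) (dist x z) with hle | hle
  · obtain ⟨q, hq, hxq⟩ := hS.exists_dist_eq dist_nonneg hle
    refine ⟨q, hq, ?_⟩
    have h1 := hS.dist_add_dist hq
    have h2 := hc p q x z
    have h3 : max (dist p x + dist q z) (dist p z + dist q x) ≤ dist x z + e := by
      refine max_le ?_ ?_
      · rw [dist_comm p x]; linarith
      · rw [dist_comm q x]; linarith
    linarith
  · exact ⟨z, hS.right_mem, by linarith⟩

/-- For `p` between `x` and `y`, the condition on `x, y, p, z` says that `p` has excess at most `c`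
over one of the other two sides; being close to that side costs another `c`. -/
theorem FourPointCondition.isGromovHyperbolic {c : ℝ}
    (hc : FourPointCondition (dist : X → X → ℝ) c) (h0 : 0 ≤ c) : IsGromovHyperbolic X := by
  refine ⟨(c + c).toNNReal, ?_⟩
  intro x y z S₁ S₂ S₃ h₁ h₂ h₃ p hp
  have key : ∃ q ∈ S₂ ∪ S₃, dist p q ≤ c + c := by
    have h1 := h₁.dist_add_dist hp
    have h2 := hc x y p z
    rcases le_total (dist x p + dist y z) (dist x z + dist y p) with hm | hm
    · rw [max_eq_right hm] at h2
      obtain ⟨q, hq, hpq⟩ := hc.exists_dist_le h₃.symm (p := p) (e := c)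
        (by rw [dist_comm y p] at h2; linarith) h0 h0
      exact ⟨q, Or.inr hq, hpq⟩
    · rw [max_eq_left hm] at h2
      obtain ⟨q, hq, hpq⟩ := hc.exists_dist_le h₂ (p := p) (e := c)
        (by rw [dist_comm y p]; linarith) h0 h0
      exact ⟨q, Or.inl hq, hpq⟩
  obtain ⟨q, hq, hpq⟩ := key
  refine (Metric.infEDist_le_edist_of_mem hq).trans ?_
  rw [edist_dist]
  exact ENNReal.ofReal_le_ofReal hpq

end PseudoMetric

/-! ### Vertices, edge points and geodesics of the metric graph -/

namespace MetricGraph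

variable {V : Type*} {G : SimpleGraph V}

theorem vertex_weight_self (v : V) : (vertex G v).weight v = 1 := by simp [vertex]

theorem vertex_weight_of_ne {v w : V} (h : w ≠ v) : (vertex G v).weight w = 0 := by
  simp [vertex, h]

theorem eq_of_vertex_weight_ne_zero {v w : V} (h : (vertex G v).weight w ≠ 0) : w = v := by
  by_contra hne
  exact h (vertex_weight_of_ne hne)

theorem onEdge_vertex_left {u v : V} (h : G.Adj u v) : (vertex G u).OnEdge u v :=
  ⟨h, fun _ hw _ => vertex_weight_of_ne hw⟩

theorem edist_vertex_vertex (u v : V) : edist (vertex G u) (vertex G v) = (G.edist u v : ℝ≥0∞) := by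
  refine le_antisymm ?_ ?_
  · have := edist_le_of_near (x := vertex G u) (y := vertex G v) (u := u) (v := v)
      (Or.inl (by simp [vertex_weight_self])) (Or.inl (by simp [vertex_weight_self]))
    simpa [vertex_weight_self] using this
  · refine le_sInf ?_
    rintro r (⟨a, b, ha, hb, rfl⟩ | ⟨a, b, ha, hb, rfl⟩)
    · rw [eq_of_vertex_weight_ne_zero ha, eq_of_vertex_weight_ne_zero hb]
      simp [vertex_weight_self]
    · rcases eq_or_ne u v with rfl | huv
      · simp
      · have h1 := ha.mem (w := u) (by simp [vertex_weight_self])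
        have h2 := hb.mem (w := v) (by simp [vertex_weight_self])
        have hab := ha.1
        rcases h1 with rfl | rfl <;> rcases h2 with rfl | rfl
        · exact absurd rfl huv
        · simpa [vertex_weight_self, vertex_weight_of_ne huv] using adj_edist_le hab
        · simpa [vertex_weight_self, vertex_weight_of_ne huv.symm] using adj_edist_le hab.symm
        · exact absurd rfl huv

theorem exists_edist_vertex_le_one (x : MetricGraph G) : ∃ u, edist x (vertex G u) ≤ 1 := by
  obtain ⟨u, hu⟩ := x.exists_ne_zero
  refine ⟨u, ?_⟩
  have := edist_le_of_near (x := x) (y := vertex G u) (u := u) (v := u) (Or.inl hu)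
      (Or.inl (by simp [vertex_weight_self]))
  refine this.trans ?_
  simpa [vertex_weight_self] using x.nonneg u

theorem OnEdge.edist_vertex_le_one {x : MetricGraph G} {u v : V} (h : x.OnEdge u v) :
    edist x (vertex G u) ≤ 1 := by
  refine (edist_le_of_onEdge h (onEdge_vertex_left h.1)).trans ?_
  rw [vertex_weight_self, abs_sub_comm, abs_of_nonneg (by linarith [x.weight_le_one u])]
  simpa using x.nonneg u

open Classical in
/-- The point at distance `t` from `u` on the edge `uv`. -/
noncomputable def edgePoint {u v : V} (h : G.Adj u v) (t : ℝ) (ht : t ∈ Set.Icc (0 : ℝ) 1) :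
    MetricGraph G where
  weight w := if w = u then 1 - t else if w = v then t else 0
  nonneg w := by
    split_ifs
    · linarith [ht.2]
    · exact ht.1
    · exact le_rfl
  carried := Or.inr ⟨u, v, h, by simp [h.ne.symm], fun w h1 h2 => by simp [h1, h2]⟩

theorem edgePoint_onEdge {u v : V} (h : G.Adj u v) (t : ℝ) (ht : t ∈ Set.Icc (0 : ℝ) 1) :
    (edgePoint h t ht).OnEdge u v :=
  ⟨h, fun w h1 h2 => by simp [edgePoint, h1, h2]⟩

theorem edgePoint_weight_left {u v : V} (h : G.Adj u v) (t : ℝ) (ht : t ∈ Set.Icc (0 : ℝ) 1) :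
    (edgePoint h t ht).weight u = 1 - t := by simp [edgePoint]

theorem edgePoint_weight_right {u v : V} (h : G.Adj u v) (t : ℝ) (ht : t ∈ Set.Icc (0 : ℝ) 1) :
    (edgePoint h t ht).weight v = t := by simp [edgePoint, h.ne.symm]

theorem edgePoint_zero {u v : V} (h : G.Adj u v) (ht : (0 : ℝ) ∈ Set.Icc (0 : ℝ) 1) :
    edgePoint h 0 ht = vertex G u := by
  ext w
  rcases eq_or_ne w u with rfl | hw
  · simp [edgePoint, vertex_weight_self]
  · simp [edgePoint, vertex_weight_of_ne hw, hw]

open Classical in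
/-- The path in the metric graph running at unit speed along the vertices `f 0, f 1, …`. -/
noncomputable def unitSpeedPath (G : SimpleGraph V) (f : ℕ → V) (t : ℝ) : MetricGraph G :=
  -- The default value serves the final vertex of a path, after which no edge need follow. For `t ≥
  -- 0` the second conjunct is automatic.
  if h : G.Adj (f ⌊t⌋₊) (f (⌊t⌋₊ + 1)) ∧ t - ⌊t⌋₊ ∈ Set.Icc (0 : ℝ) 1 then
    edgePoint h.1 (t - ⌊t⌋₊) h.2
  else vertex G (f ⌊t⌋₊)

theorem unitSpeedPath_natCast (f : ℕ → V) (n : ℕ) : unitSpeedPath G f n = vertex G (f n) := by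
  unfold unitSpeedPath
  simp only [Nat.floor_natCast]
  split_ifs with h
  · simp only [sub_self]
    exact edgePoint_zero _ _
  · rfl

theorem edist_unitSpeedPath_left {f : ℕ → V} {t : ℝ} (ht : 0 ≤ t) :
    edist (vertex G (f ⌊t⌋₊)) (unitSpeedPath G f t) ≤ ENNReal.ofReal (t - ⌊t⌋₊) := by
  have h1 := Nat.floor_le ht
  unfold unitSpeedPath
  split_ifs with h
  · refine (edist_le_of_onEdge (onEdge_vertex_left h.1) (edgePoint_onEdge _ _ _)).trans ?_
    rw [vertex_weight_self, edgePoint_weight_left, sub_sub_cancel, abs_of_nonneg (by linarith)]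
  · simp

theorem edist_unitSpeedPath_right {f : ℕ → V} {t : ℝ} (ht : 0 ≤ t)
    (hadj : G.Adj (f ⌊t⌋₊) (f (⌊t⌋₊ + 1))) :
    edist (unitSpeedPath G f t) (vertex G (f (⌊t⌋₊ + 1))) ≤ ENNReal.ofReal (⌊t⌋₊ + 1 - t) := by
  have h1 := Nat.floor_le ht
  have h2 := Nat.lt_floor_add_one t
  have h : G.Adj (f ⌊t⌋₊) (f (⌊t⌋₊ + 1)) ∧ t - ⌊t⌋₊ ∈ Set.Icc (0 : ℝ) 1 :=
    ⟨hadj, by linarith, by linarith⟩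
  unfold unitSpeedPath
  rw [dif_pos h]
  refine (edist_le_of_onEdge (edgePoint_onEdge _ _ _).symm (onEdge_vertex_left h.1.symm)).trans ?_
  rw [vertex_weight_self, edgePoint_weight_right, abs_sub_comm, abs_of_nonneg (by linarith)]
  exact ENNReal.ofReal_le_ofReal (by linarith)

theorem edist_vertex_le_of_adj {f : ℕ → V} {n : ℕ} (hf : ∀ i < n, G.Adj (f i) (f (i + 1)))
    {i j : ℕ} (hij : i ≤ j) (hj : j ≤ n) :
    edist (vertex G (f i)) (vertex G (f j)) ≤ ENNReal.ofReal (j - i) := by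
  induction j, hij using Nat.le_induction with
  | base => simp
  | succ j hij ih =>
    refine (edist_triangle _ (vertex G (f j)) _).trans ?_
    have h1 : edist (vertex G (f j)) (vertex G (f (j + 1))) ≤ ENNReal.ofReal 1 := by
      rw [edist_vertex_vertex, ENNReal.ofReal_one]
      exact adj_edist_le (hf j (by omega))
    have hij' : (i : ℝ) ≤ j := by exact_mod_cast hij
    calc _ ≤ ENNReal.ofReal (j - i) + ENNReal.ofReal 1 := add_le_add (ih (by omega)) h1
      _ = _ := by
        rw [← ENNReal.ofReal_add (by linarith) zero_le_one]
        push_cast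
        congr 1
        ring

theorem edist_unitSpeedPath_le {f : ℕ → V} {n : ℕ} (hf : ∀ i < n, G.Adj (f i) (f (i + 1)))
    {s t : ℝ} (hs : 0 ≤ s) (hst : s ≤ t) (ht : t ≤ n) :
    edist (unitSpeedPath G f s) (unitSpeedPath G f t) ≤ ENNReal.ofReal (t - s) := by
  have ht0 : 0 ≤ t := hs.trans hst
  have hfl : ⌊s⌋₊ ≤ ⌊t⌋₊ := Nat.floor_mono hst
  have htn : ⌊t⌋₊ ≤ n := Nat.floor_le_of_le ht
  have s1 := Nat.floor_le hs
  have s2 := Nat.lt_floor_add_one s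
  have t1 := Nat.floor_le ht0
  have t2 := Nat.lt_floor_add_one t
  rcases hfl.lt_or_eq with hlt | heq
  · have h1 := edist_unitSpeedPath_right hs (hf ⌊s⌋₊ (by omega))
    have h2 := edist_vertex_le_of_adj hf (i := ⌊s⌋₊ + 1) (j := ⌊t⌋₊) (by omega) htn
    have h3 := edist_unitSpeedPath_left (G := G) (f := f) ht0
    have hlt' : (⌊s⌋₊ : ℝ) + 1 ≤ ⌊t⌋₊ := by exact_mod_cast hlt
    refine (edist_triangle4 _ (vertex G (f (⌊s⌋₊ + 1))) (vertex G (f ⌊t⌋₊)) _).trans ?_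
    refine (add_le_add (add_le_add h1 h2) h3).trans ?_
    rw [← ENNReal.ofReal_add (by linarith) (by push_cast; linarith),
      ← ENNReal.ofReal_add (by push_cast; linarith) (by linarith)]
    refine ENNReal.ofReal_le_ofReal ?_
    push_cast
    linarith
  · rcases htn.lt_or_eq with hlt | hn
    · have h := hf ⌊s⌋₊ (by omega)
      have hS : G.Adj (f ⌊s⌋₊) (f (⌊s⌋₊ + 1)) ∧ s - ⌊s⌋₊ ∈ Set.Icc (0 : ℝ) 1 :=
        ⟨h, by linarith, by linarith⟩
      have hT : G.Adj (f ⌊t⌋₊) (f (⌊t⌋₊ + 1)) ∧ t - ⌊t⌋₊ ∈ Set.Icc (0 : ℝ) 1 :=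
        ⟨heq ▸ h, by linarith, by linarith⟩
      have e1 : (unitSpeedPath G f s).OnEdge (f ⌊s⌋₊) (f (⌊s⌋₊ + 1)) := by
        unfold unitSpeedPath
        rw [dif_pos hS]
        exact edgePoint_onEdge _ _ _
      have e2 : (unitSpeedPath G f t).OnEdge (f ⌊t⌋₊) (f (⌊t⌋₊ + 1)) := by
        unfold unitSpeedPath
        rw [dif_pos hT]
        exact edgePoint_onEdge _ _ _
      have w1 : (unitSpeedPath G f s).weight (f ⌊s⌋₊) = 1 - (s - ⌊s⌋₊) := by
        unfold unitSpeedPath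
        rw [dif_pos hS]
        exact edgePoint_weight_left _ _ _
      have w2 : (unitSpeedPath G f t).weight (f ⌊t⌋₊) = 1 - (t - ⌊t⌋₊) := by
        unfold unitSpeedPath
        rw [dif_pos hT]
        exact edgePoint_weight_left _ _ _
      rw [← heq] at e2 w2
      refine (edist_le_of_onEdge e1 e2).trans (ENNReal.ofReal_le_ofReal ?_)
      rw [w1, w2]
      exact le_of_eq (by rw [abs_of_nonneg (by linarith)]; ring)
    -- Both floors equal `n`: no edge is available here, but both times are the endpoint.
    · have hs' : s = n := by
        rw [← heq] at hn
        rw [hn] at s1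
        linarith
      have : s = t := by linarith
      subst this
      simp

/-- The path is 1-Lipschitz and its ends are at distance exactly `n`, so by the triangle inequality
no intermediate stretch can be shortened. -/
theorem isGeodesicSegment_unitSpeedPath {f : ℕ → V} {n : ℕ}
    (hf : ∀ i < n, G.Adj (f i) (f (i + 1))) (hn : G.edist (f 0) (f n) = n) :
    IsGeodesicSegment (vertex G (f 0)) (vertex G (f n))
      (unitSpeedPath G f '' Set.Icc 0 (n : ℝ)) := by
  have h0 : unitSpeedPath G f 0 = vertex G (f 0) := by
    simpa using unitSpeedPath_natCast (G := G) f 0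
  have key : ∀ s t : ℝ, 0 ≤ s → s ≤ t → t ≤ n →
      edist (unitSpeedPath G f s) (unitSpeedPath G f t) = ENNReal.ofReal (t - s) := by
    intro s t hs hst ht
    refine le_antisymm (edist_unitSpeedPath_le hf hs hst ht) ?_
    have h1 := edist_unitSpeedPath_le (G := G) hf le_rfl hs (hst.trans ht)
    have h2 := edist_unitSpeedPath_le (G := G) hf (hs.trans hst) ht le_rfl
    have h3 := edist_triangle4 (unitSpeedPath G f 0) (unitSpeedPath G f s) (unitSpeedPath G f t)
      (unitSpeedPath G f n)
    have h4 := edist_unitSpeedPath_le (G := G) hf hs hst ht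
    have e : edist (unitSpeedPath G f 0) (unitSpeedPath G f n) = ENNReal.ofReal n := by
      rw [h0, unitSpeedPath_natCast, edist_vertex_vertex, hn]
      simp
    rw [e] at h3
    have hfin : edist (unitSpeedPath G f s) (unitSpeedPath G f t) ≠ ⊤ :=
      (h4.trans_lt ENNReal.ofReal_lt_top).ne
    rw [← ENNReal.ofReal_toReal hfin] at h3 ⊢
    have h5 := h3.trans (add_le_add (add_le_add_left h1 _) h2)
    rw [← ENNReal.ofReal_add (by linarith) ENNReal.toReal_nonneg,
      ← ENNReal.ofReal_add (add_nonneg (by linarith) ENNReal.toReal_nonneg) (by linarith),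
      ENNReal.ofReal_le_ofReal_iff (add_nonneg (add_nonneg (by linarith) ENNReal.toReal_nonneg)
        (by linarith))] at h5
    exact ENNReal.ofReal_le_ofReal (by linarith)
  refine ⟨n, unitSpeedPath G f, n.cast_nonneg, h0, unitSpeedPath_natCast f n, ?_, rfl⟩
  intro s hs t ht
  rcases le_total s t with hst | hst
  · rw [key s t hs.1 hst ht.2, abs_sub_comm, abs_of_nonneg (by linarith)]
  · rw [edist_comm, key t s ht.1 hst hs.2, abs_of_nonneg (by linarith)]

end MetricGraph

/-! ### Minimal cycles are isometric, hence short in a hyperbolic graph -/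

namespace SimpleGraph

variable {V : Type*} {G : SimpleGraph V}

/-- Two vertices of a cycle split it into two arcs. -/
theorem Walk.IsCycle.exists_arcs {a u v : V} {C : G.Walk a a} (hC : C.IsCycle)
    (hu : u ∈ C.support) (hv : v ∈ C.support) (huv : u ≠ v) :
    ∃ p q : G.Walk u v, p.IsPath ∧ q.IsPath ∧ p.length + q.length = C.length ∧
      p.toSubgraph ⊔ q.toSubgraph = C.toSubgraph := by
  classical
  have hv' : v ∈ (C.rotate u hu).support := by
    have h := (C.rotate u hu).mem_verts_toSubgraph (w := v)
    rw [Walk.toSubgraph_rotate, Walk.mem_verts_toSubgraph] at h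
    exact h.1 hv
  have hC' : (C.rotate u hu).IsCycle := hC.rotate hu
  have hspec := (C.rotate u hu).take_spec hv'
  refine ⟨(C.rotate u hu).takeUntil v hv', ((C.rotate u hu).dropUntil v hv').reverse,
    hC'.isPath_takeUntil hv', ?_, ?_, ?_⟩
  · refine Walk.IsPath.reverse ?_
    rw [← hspec] at hC'
    exact hC'.isPath_of_append_right (Walk.not_nil_of_ne huv)
  · rw [Walk.length_reverse, ← Walk.length_append, hspec, Walk.length_rotate]
  · rw [Walk.toSubgraph_reverse, ← Walk.toSubgraph_append, hspec, Walk.toSubgraph_rotate]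

theorem Subgraph.spanningCoe_dist_le {H : G.Subgraph} {u v : V} (p : G.Walk u v)
    (hp : p.toSubgraph ≤ H) :
    H.spanningCoe.Reachable u v ∧ H.spanningCoe.dist u v ≤ p.length := by
  have h : ∀ e ∈ p.edges, e ∈ H.spanningCoe.edgeSet := by
    intro e he
    rw [Subgraph.edgeSet_spanningCoe]
    exact Subgraph.edgeSet_mono hp (p.mem_edges_toSubgraph.2 he)
  refine ⟨⟨p.transfer _ h⟩, ?_⟩
  rw [← p.length_transfer h]
  exact dist_le _

theorem Walk.IsCycle.spanningCoe_reachable {a u v : V} {C : G.Walk a a} (hC : C.IsCycle)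
    (hu : u ∈ C.support) (hv : v ∈ C.support) : C.toSubgraph.spanningCoe.Reachable u v := by
  rcases eq_or_ne u v with rfl | huv
  · exact Reachable.refl _
  · obtain ⟨p, q, -, -, -, hpq⟩ := hC.exists_arcs hu hv huv
    exact (Subgraph.spanningCoe_dist_le p (hpq ▸ le_sup_left)).1

theorem IsShortcut.exists_isReduction_of_arc {a u v : V} {C : G.Walk a a} (hodd : Odd C.length)
    {η g : G.Walk u v} (hg : IsShortcut g C) (hgp : g.IsPath) (huv : u ≠ v) (hη : η.IsPath)
    (hηC : η.toSubgraph ≤ C.toSubgraph) (hpar : Odd (η.length + g.length)) :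
    ∃ (b : V) (C' : G.Walk b b), C'.IsCycle ∧ IsReduction C' C := by
  refine ⟨u, η.append g.reverse, ?_, ?_, hodd, u, v, η, g, hη, hηC, hg, ?_⟩
  · refine hη.isCycle_append hgp.reverse ?_ (Or.inl ?_)
    · intro x hx hx'
      have h1 : x ∈ η.support := List.mem_of_mem_tail hx
      have h2 : x ∈ g.support := by
        have := List.mem_of_mem_tail hx'
        simpa using this
      have h3 : x ∈ ({u, v} : Set V) := by
        rw [← hg.1]
        exact ⟨g.mem_verts_toSubgraph.2 h2, Subgraph.verts_mono hηC (η.mem_verts_toSubgraph.2 h1)⟩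
      rcases h3 with rfl | rfl
      · have := hη.support_nodup
        rw [← Walk.cons_tail_support] at this
        exact (List.nodup_cons.1 this).1 hx
      · have := hgp.reverse.support_nodup
        rw [← Walk.cons_tail_support] at this
        exact (List.nodup_cons.1 this).1 hx'
    -- The arc is strictly longer than the nonempty shortcut, so it has at least two edges and the
    -- closed walk does not degenerate to an edge run back and forth.
    · have h1 := (Subgraph.spanningCoe_dist_le η hηC).2
      have h2 := hg.2.2
      have h3 : g.length ≠ 0 := fun h => huv (Walk.eq_of_length_eq_zero h)
      omega
  · rwa [Walk.length_append, Walk.length_reverse]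
  · rw [Walk.toSubgraph_append, Walk.toSubgraph_reverse]

/-- The two arcs have lengths of odd sum, so exactly one of them has parity opposite to that of `g`
and closes up with it to an odd cycle. -/
theorem IsShortcut.exists_isReduction {a u v : V} {C : G.Walk a a} (hC : C.IsCycle)
    (hodd : Odd C.length) {g : G.Walk u v} (hg : IsShortcut g C) (hgp : g.IsPath) (huv : u ≠ v) :
    ∃ (b : V) (C' : G.Walk b b), C'.IsCycle ∧ IsReduction C' C := by
  have hmem : ∀ x ∈ ({u, v} : Set V), x ∈ C.support := by
    intro x hx
    rw [← hg.1] at hx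
    exact C.mem_verts_toSubgraph.1 hx.2
  obtain ⟨p, q, hp, hq, hlen, hsub⟩ := hC.exists_arcs (hmem u (by simp)) (hmem v (by simp)) huv
  by_cases h : Odd (p.length + g.length)
  · exact hg.exists_isReduction_of_arc hodd hgp huv hp (hsub ▸ le_sup_left) h
  · refine hg.exists_isReduction_of_arc hodd hgp huv hq (hsub ▸ le_sup_right) ?_
    rw [← hlen] at hodd
    grind

/-- A minimal cycle of a connected graph is isometrically embedded. -/
theorem IsMinimalCycle.spanningCoe_dist_le (hG : G.Connected) {a : V} {C : G.Walk a a}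
    (hC : IsMinimalCycle C) {u v : V} (hu : u ∈ C.support) (hv : v ∈ C.support) :
    C.toSubgraph.spanningCoe.dist u v ≤ G.dist u v := by
  classical
  obtain ⟨n, hn⟩ : ∃ n, G.dist u v = n := ⟨_, rfl⟩
  induction n using Nat.strong_induction_on generalizing u v with
  | _ n ih =>
    by_contra! hlt
    have huv : u ≠ v := by
      rintro rfl
      simp at hlt
    have hpos := hG.pos_dist_of_ne huv
    obtain ⟨g, hgp, hgl⟩ := hG.exists_path_of_dist u v
    -- An inner vertex of `g` on `C` would split `u, v` into two pairs at smaller distance; the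
    -- induction hypothesis for both adds up to the bound for `u, v`.
    have hverts : g.toSubgraph.verts ∩ C.toSubgraph.verts = {u, v} := by
      refine Set.Subset.antisymm ?_ ?_
      · rintro x ⟨hxg, hxC⟩
        rw [Walk.mem_verts_toSubgraph] at hxg hxC
        by_contra hx
        simp only [Set.mem_insert_iff, Set.mem_singleton_iff, not_or] at hx
        have h1 := G.dist_le (g.takeUntil x hxg)
        have h2 := G.dist_le (g.dropUntil x hxg)
        have h3 : (g.takeUntil x hxg).length + (g.dropUntil x hxg).length = g.length := by
          rw [← Walk.length_append, Walk.take_spec]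
        have h4 := hG.pos_dist_of_ne (Ne.symm hx.1)
        have h5 := hG.pos_dist_of_ne hx.2
        have h6 := ih _ (by omega) hu hxC rfl
        have h7 := ih _ (by omega) hxC hv rfl
        have h8 := (hC.1.spanningCoe_reachable hu hxC).dist_triangle_left v
        omega
      · rintro x (rfl | rfl)
        · exact ⟨g.start_mem_verts_toSubgraph, C.mem_verts_toSubgraph.2 hu⟩
        · exact ⟨g.end_mem_verts_toSubgraph, C.mem_verts_toSubgraph.2 hv⟩
    have hedges : g.toSubgraph.edgeSet ∩ C.toSubgraph.edgeSet = ∅ := by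
      refine Set.eq_empty_of_forall_notMem ?_
      intro e
      induction e using Sym2.ind with
      | _ x y =>
        rintro ⟨hg, hc⟩
        rw [Subgraph.mem_edgeSet] at hg hc
        have hx : x ∈ ({u, v} : Set V) := hverts ▸ ⟨hg.fst_mem, hc.fst_mem⟩
        have hy : y ∈ ({u, v} : Set V) := hverts ▸ ⟨hg.snd_mem, hc.snd_mem⟩
        have hne : x ≠ y := hg.ne
        -- A common edge can only join `u` to `v`, which would make their distance in `C` equal to
        -- one.
        have hadj : C.toSubgraph.spanningCoe.Adj u v := by
          rcases hx with rfl | rfl <;> rcases hy with rfl | rfl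
          · exact absurd rfl hne
          · exact hc
          · exact hc.symm
          · exact absurd rfl hne
        rw [dist_eq_one_iff_adj.2 hadj] at hlt
        omega
    obtain ⟨b, C', hC', hred⟩ := IsShortcut.exists_isReduction hC.1 hC.2.1
      (g := g) ⟨hverts, hedges, hgl ▸ hlt⟩ hgp huv
    exact hC.2.2 b C' hC' hred

/-- An integer potential changing by at most one along edges bounds distances from below. -/
theorem abs_sub_le_length {f : V → ℤ} (hf : ∀ u v, G.Adj u v → |f u - f v| ≤ 1) {u v : V}
    (p : G.Walk u v) : |f u - f v| ≤ p.length := by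
  induction p with
  | nil => simp
  | cons h p ih =>
    have := hf _ _ h
    rw [Walk.length_cons]
    push_cast
    rw [abs_le] at *
    omega

/-- The distance inside a cycle, bounded from below through the positions of the vertices. -/
theorem Walk.IsCycle.min_le_spanningCoe_dist {a : V} {C : G.Walk a a} (hC : C.IsCycle) {i j : ℕ}
    (hij : i ≤ j) (hj : j ≤ C.length) :
    min (j - i) (C.length - (j - i)) ≤
      C.toSubgraph.spanningCoe.dist (C.getVert i) (C.getVert j) := by
  classical
  -- The potential is the cyclic distance of position `k` from position `i`.
  let φ : ℕ → ℤ := fun k => min |(k : ℤ) - i| (C.length - |(k : ℤ) - i|)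
  have hex : ∀ v, ∃ k, v ∈ C.support → k ≤ C.length ∧ C.getVert k = v := by
    intro v
    by_cases h : v ∈ C.support
    · obtain ⟨k, h1, h2⟩ := Walk.mem_support_iff_exists_getVert.1 h
      exact ⟨k, fun _ => ⟨h2, h1⟩⟩
    · exact ⟨0, fun h' => absurd h' h⟩
  choose idx hidx using hex
  -- A vertex of the cycle determines its position except that positions `0` and `C.length`
  -- coincide, where `φ` takes equal values. Hence `φ` is well defined on vertices, whatever `idx`
  -- chooses.
  have hφ : ∀ k ≤ C.length, φ (idx (C.getVert k)) = φ k := by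
    intro k hk
    obtain ⟨h1, h2⟩ := hidx (C.getVert k) (C.getVert_mem_support k)
    set m := idx (C.getVert k)
    have h0 : C.getVert C.length = C.getVert 0 := by simp
    have hφ0 : φ C.length = φ 0 := by
      simp only [φ]
      push_cast
      rw [abs_of_nonneg (by omega), abs_of_nonpos (by omega)]
      omega
    have hinj := hC.getVert_injOn
    have hL := hC.three_le_length
    rcases Nat.eq_zero_or_pos m with hm | hm <;> rcases Nat.eq_zero_or_pos k with hk0 | hk0
    · rw [hm, hk0]
    · rw [hm, ← h0] at h2
      rw [hm, ← hφ0, hinj ⟨by omega, le_rfl⟩ ⟨hk0, hk⟩ h2]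
    · rw [hk0, ← h0] at h2
      rw [hk0, ← hφ0, hinj ⟨hm, h1⟩ ⟨by omega, le_rfl⟩ h2]
    · rw [hinj ⟨hm, h1⟩ ⟨hk0, hk⟩ h2]
  have hlip : ∀ u v, C.toSubgraph.spanningCoe.Adj u v → |φ (idx u) - φ (idx v)| ≤ 1 := by
    have hstep : ∀ k, |φ k - φ (k + 1)| ≤ 1 := by
      intro k
      simp only [φ]
      push_cast
      rw [abs_le]
      rcases abs_cases ((k : ℤ) - i) with h1 | h1 <;>
        rcases abs_cases ((k : ℤ) + 1 - i) with h2 | h2 <;>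
        rw [h1.1, h2.1] <;> omega
    intro u v huv
    obtain ⟨k, hk, hkl⟩ := C.toSubgraph_adj_iff.1 (show C.toSubgraph.Adj u v from huv)
    rcases Sym2.eq_iff.1 hk with ⟨rfl, rfl⟩ | ⟨rfl, rfl⟩
    · rw [hφ _ hkl.le, hφ _ hkl]
      exact hstep k
    · rw [hφ _ hkl.le, hφ _ hkl, abs_sub_comm]
      exact hstep k
  obtain ⟨p, hp⟩ := (hC.spanningCoe_reachable (C.getVert_mem_support i)
    (C.getVert_mem_support j)).exists_walk_length_eq_dist
  have h := abs_sub_le_length (f := fun v => φ (idx v)) hlip p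
  rw [hφ i (hij.trans hj), hφ j hj, hp] at h
  simp only [φ, sub_self, abs_zero] at h
  rw [abs_of_nonneg (show (0 : ℤ) ≤ (j : ℤ) - i by omega), abs_le] at h
  omega

theorem dist_getVert_le {u v : V} (p : G.Walk u v) {i j : ℕ} (hij : i ≤ j) :
    G.dist (p.getVert i) (p.getVert j) ≤ j - i := by
  have h := (G.dist_le ((p.drop i).take (j - i))).trans
    ((Walk.take_length _ _).le.trans (min_le_left _ _))
  rwa [Walk.drop_getVert, Nat.add_sub_cancel' hij] at h

/-- Four points at quarter positions of an isometric cycle violate the four-point condition if the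
cycle is long: the diagonals sum to at least `4 * k`, opposite sides to at most `2 * k + 3`, the `3`
being the rounding in `L / 4`. -/
theorem IsMinimalCycle.length_le (hG : G.Connected) {c : ℕ}
    (hc : FourPointCondition (fun u v => (G.dist u v : ℝ)) c) {a : V} {C : G.Walk a a}
    (hC : IsMinimalCycle C) : C.length ≤ 2 * c + 10 := by
  set L := C.length with hL
  set k := L / 4 with hk
  have hd : ∀ i j, i ≤ j → j ≤ L → min (j - i) (L - (j - i)) ≤
      G.dist (C.getVert i) (C.getVert j) := fun i j hij hj =>
    (hC.1.min_le_spanningCoe_dist hij hj).trans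
      (hC.spanningCoe_dist_le hG (C.getVert_mem_support i) (C.getVert_mem_support j))
  have h02 := hd 0 (2 * k) (by omega) (by omega)
  have h13 := hd k (3 * k) (by omega) (by omega)
  have h01 := dist_getVert_le C (i := 0) (j := k) (by omega)
  have h12 := dist_getVert_le C (i := k) (j := 2 * k) (by omega)
  have h23 := dist_getVert_le C (i := 2 * k) (j := 3 * k) (by omega)
  have h30 := dist_getVert_le C (i := 3 * k) (j := L) (by omega)
  have hLa : C.getVert L = C.getVert 0 := by simp [hL]
  rw [hLa, dist_comm] at h30
  have h := hc (C.getVert 0) (C.getVert (2 * k)) (C.getVert k) (C.getVert (3 * k))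
  simp only at h
  have h' : G.dist (C.getVert 0) (C.getVert (2 * k)) + G.dist (C.getVert k) (C.getVert (3 * k)) ≤
      max (G.dist (C.getVert 0) (C.getVert k) + G.dist (C.getVert (2 * k)) (C.getVert (3 * k)))
        (G.dist (C.getVert 0) (C.getVert (3 * k)) + G.dist (C.getVert (2 * k)) (C.getVert k))
        + c := by exact_mod_cast h
  rw [dist_comm (u := C.getVert (2 * k)) (v := C.getVert k)] at h'
  omega

end SimpleGraph

/-! ### From thin triangles to the four-point condition on vertices -/

namespace SimpleGraph

variable {V W : Type*} {G : SimpleGraph V} {H : SimpleGraph W}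

theorem Connected.edist_vertex_vertex (hG : G.Connected) (u v : V) :
    EDist.edist (MetricGraph.vertex G u) (MetricGraph.vertex G v) = (G.dist u v : ℝ≥0∞) := by
  rw [MetricGraph.edist_vertex_vertex, ← (hG u v).coe_dist_eq_edist]
  simp

/-- This translates geodesics of the metric graph into betweenness of vertices. Shortest walks from
`x` to `p` and from `p` to `y` concatenate to a shortest walk, and a point of the resulting segment
is within one of the last vertex passed. -/
theorem Connected.exists_isGeodesicSegment (hG : G.Connected) {x y p : V}
    (h : G.dist x p + G.dist p y = G.dist x y) :
    ∃ S, IsGeodesicSegment (MetricGraph.vertex G x) (MetricGraph.vertex G y) S ∧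
      MetricGraph.vertex G p ∈ S ∧ ∀ s ∈ S, ∃ q, G.dist x q + G.dist q y = G.dist x y ∧
        EDist.edist s (MetricGraph.vertex G q) ≤ 1 := by
  obtain ⟨w₁, h₁⟩ := hG.exists_walk_length_eq_dist x p
  obtain ⟨w₂, h₂⟩ := hG.exists_walk_length_eq_dist p y
  obtain ⟨w, hw⟩ : ∃ w, w = w₁.append w₂ := ⟨_, rfl⟩
  have hlen : w.length = G.dist x y := by rw [hw, Walk.length_append, h₁, h₂, h]
  have hp : w.getVert w₁.length = p := by simp [hw, Walk.getVert_append]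
  have hadj : ∀ i < w.length, G.Adj (w.getVert i) (w.getVert (i + 1)) :=
    fun i hi => w.adj_getVert_succ hi
  have hS := MetricGraph.isGeodesicSegment_unitSpeedPath hadj (by
    rw [w.getVert_zero, w.getVert_length, hlen]
    exact (hG x y).coe_dist_eq_edist.symm)
  rw [w.getVert_zero, w.getVert_length] at hS
  refine ⟨_, hS, ⟨w₁.length, ⟨by positivity, ?_⟩, ?_⟩, ?_⟩
  · exact_mod_cast (by omega : w₁.length ≤ w.length)
  · rw [MetricGraph.unitSpeedPath_natCast, hp]
  · rintro s ⟨t, ht, rfl⟩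
    have hfl : ⌊t⌋₊ ≤ w.length := Nat.floor_le_of_le ht.2
    refine ⟨w.getVert ⌊t⌋₊, ?_, ?_⟩
    · have e1 := dist_getVert_le w (i := 0) (j := ⌊t⌋₊) (Nat.zero_le _)
      have e2 := dist_getVert_le w hfl
      rw [w.getVert_zero] at e1
      rw [w.getVert_length] at e2
      have e3 : G.dist x y ≤ _ := hG.dist_triangle (v := w.getVert ⌊t⌋₊)
      omega
    · rw [PseudoEMetricSpace.edist_comm]
      refine (MetricGraph.edist_unitSpeedPath_left ht.1).trans ?_
      rw [ENNReal.ofReal_le_one]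
      linarith [Nat.lt_floor_add_one t]

/-- In a hyperbolic graph, geodesic triangles with corners at vertices are thin, in terms of the
vertices lying between two corners. -/
theorem IsHyperbolic.exists_thin (hG : G.Connected) (h : G.IsHyperbolic) :
    ∃ D : ℕ, ∀ x y z p, G.dist x p + G.dist p y = G.dist x y →
      ∃ q, (G.dist y q + G.dist q z = G.dist y z ∨ G.dist z q + G.dist q x = G.dist z x) ∧
        G.dist p q ≤ D := by
  obtain ⟨δ, hδ⟩ := h
  -- One unit is spent because the infimum may not be attained, one to move from a point of the
  -- segment to a vertex.
  refine ⟨⌈δ⌉₊ + 2, fun x y z p hp => ?_⟩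
  obtain ⟨S₁, h₁, hpS, -⟩ := hG.exists_isGeodesicSegment hp
  obtain ⟨S₂, h₂, -, hS₂⟩ := hG.exists_isGeodesicSegment (x := y) (y := z) (p := y) (by simp)
  obtain ⟨S₃, h₃, -, hS₃⟩ := hG.exists_isGeodesicSegment (x := z) (y := x) (p := z) (by simp)
  have hinf : Metric.infEDist (MetricGraph.vertex G p) (S₂ ∪ S₃) < δ + 1 :=
    (hδ _ _ _ _ _ _ h₁ h₂ h₃ _ hpS).trans_lt (by
      exact ENNReal.lt_add_right ENNReal.coe_ne_top one_ne_zero)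
  obtain ⟨s, hs, hps⟩ := Metric.infEDist_lt_iff.1 hinf
  obtain ⟨q, hq, hsq⟩ : ∃ q, (G.dist y q + G.dist q z = G.dist y z ∨
      G.dist z q + G.dist q x = G.dist z x) ∧ EDist.edist s (MetricGraph.vertex G q) ≤ 1 := by
    rcases hs with hs | hs
    · obtain ⟨q, h1, h2⟩ := hS₂ s hs
      exact ⟨q, Or.inl h1, h2⟩
    · obtain ⟨q, h1, h2⟩ := hS₃ s hs
      exact ⟨q, Or.inr h1, h2⟩
  refine ⟨q, hq, ?_⟩
  have h4 := (PseudoEMetricSpace.edist_triangle _ s _).trans (add_le_add hps.le hsq)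
  rw [hG.edist_vertex_vertex] at h4
  have h5 : (δ : ℝ≥0∞) ≤ (⌈δ⌉₊ : ℕ) := by
    exact_mod_cast Nat.le_ceil δ
  have h6 : (G.dist p q : ℝ≥0∞) ≤ ((⌈δ⌉₊ + 2 : ℕ) : ℝ≥0∞) := by
    refine h4.trans ?_
    push_cast
    rw [add_assoc, one_add_one_eq_two]
    gcongr
  exact_mod_cast h6

/-- If triangles are thin, then some point of a side is as close to the opposite corner as the
Gromov product allows. -/
theorem exists_between_near (hG : G.Connected) {D : ℕ}
    (hD : ∀ x y z p, G.dist x p + G.dist p y = G.dist x y →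
      ∃ q, (G.dist y q + G.dist q z = G.dist y z ∨ G.dist z q + G.dist q x = G.dist z x) ∧
        G.dist p q ≤ D) (p x z : V) :
    ∃ q, G.dist x q + G.dist q z = G.dist x z ∧
      2 * G.dist p q + G.dist x z ≤ G.dist x p + G.dist p z + 4 * (D + 1) := by
  obtain ⟨w, hw⟩ := hG.exists_walk_length_eq_dist x z
  have hbetween : ∀ i ≤ w.length,
      G.dist x (w.getVert i) + G.dist (w.getVert i) z = G.dist x z := by
    intro i hi
    have e1 := dist_getVert_le w (i := 0) (j := i) (Nat.zero_le _)
    have e2 := dist_getVert_le w hi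
    rw [w.getVert_zero] at e1
    rw [w.getVert_length] at e2
    have e3 : G.dist x z ≤ _ := hG.dist_triangle (v := w.getVert i)
    omega
  let P : ℕ → Prop := fun i => ∃ q, G.dist x q + G.dist q p = G.dist x p ∧
    G.dist (w.getVert i) q ≤ D
  have hP0 : P 0 := ⟨x, by simp, by simp⟩
  -- Discrete continuity along the side from `x` to `z`: it starts close to the side from `x` to
  -- `p`. If it stays so, `z` itself serves; where closeness is lost, thinness gives closeness to
  -- the side from `z` to `p`, and stepping back one vertex costs the extra `1`.
  have key : ∃ i ≤ w.length, P i ∧ ∃ q, G.dist z q + G.dist q p = G.dist z p ∧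
      G.dist (w.getVert i) q ≤ D + 1 := by
    by_cases hall : ∀ i < w.length, P i → P (i + 1)
    · have : ∀ i ≤ w.length, P i := by
        intro i
        induction i with
        | zero => exact fun _ => hP0
        | succ i ih => exact fun hi => hall i hi (ih (by omega))
      exact ⟨w.length, le_rfl, this _ le_rfl, z, by simp, by simp⟩
    · push Not at hall
      obtain ⟨i, hi, hPi, hnP⟩ := hall
      refine ⟨i, hi.le, hPi, ?_⟩
      obtain ⟨q, hq, hqD⟩ := hD x z p (w.getVert (i + 1)) (hbetween _ hi)
      rcases hq with hq | hq
      · refine ⟨q, hq, ?_⟩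
        have e1 := dist_getVert_le w (i := i) (j := i + 1) (by omega)
        have e2 : G.dist (w.getVert i) q ≤ _ := hG.dist_triangle (v := w.getVert (i + 1))
        omega
      · refine absurd ⟨q, ?_, hqD⟩ hnP
        rw [dist_comm, dist_comm (u := q), add_comm, dist_comm (u := x) (v := p), ← hq,
          add_comm (G.dist p q), dist_comm (u := q) (v := p), dist_comm (u := x) (v := q),
          add_comm]
  obtain ⟨i, hi, ⟨a, ha, haD⟩, b, hb, hbD⟩ := key
  refine ⟨w.getVert i, hbetween i hi, ?_⟩
  have h0 := hbetween i hi
  generalize w.getVert i = q at *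
  -- With `a` and `b` on the two sides at `p`, passing through `q` costs at most `2 * D` and `2 * (D
  -- + 1)` more than the respective side; the sum of the two estimates gives the claim.
  have e1 : G.dist x q ≤ G.dist x a + G.dist a q := hG.dist_triangle
  have e2 : G.dist p q ≤ G.dist p a + G.dist a q := hG.dist_triangle
  have e3 : G.dist z q ≤ G.dist z b + G.dist b q := hG.dist_triangle
  have e4 : G.dist p q ≤ G.dist p b + G.dist b q := hG.dist_triangle
  rw [dist_comm (u := a) (v := q)] at e1 e2
  rw [dist_comm (u := b) (v := q)] at e3 e4
  rw [dist_comm (u := p) (v := a)] at e2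
  rw [dist_comm (u := p) (v := b)] at e4
  rw [dist_comm (u := q) (v := z)] at h0
  rw [dist_comm (u := p) (v := z)]
  omega

/-- Half the excess of `p` over `x, z`, up to `2 * (D + 1)`, bounds its distance to some `q` between
`x` and `z`. Thinness moves `q` by `D` onto another side of the triangle with third corner `y`, and
a detour through that point `r` bounds the excess of `p` over that side. The errors are `4 * (D +
1)` and `2 * D`. -/
theorem IsHyperbolic.exists_fourPointCondition (hG : G.Connected) (h : G.IsHyperbolic) :
    ∃ c : ℕ, FourPointCondition (fun u v => (G.dist u v : ℝ)) c := by
  obtain ⟨D, hD⟩ := h.exists_thin hG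
  refine ⟨6 * D + 4, fun x z y p => ?_⟩
  obtain ⟨q, hq, hqp⟩ := exists_between_near hG hD p x z
  obtain ⟨r, hr, hqr⟩ := hD x z y q hq
  have e1 : G.dist p r ≤ G.dist p q + G.dist q r := hG.dist_triangle
  have key : G.dist x z + G.dist y p ≤
      max (G.dist x y + G.dist z p) (G.dist x p + G.dist z y) + (6 * D + 4) := by
    have c1 := G.dist_comm (u := z) (v := p)
    have c2 := G.dist_comm (u := y) (v := p)
    have c3 := G.dist_comm (u := x) (v := p)
    have c4 := G.dist_comm (u := r) (v := p)
    have c5 := G.dist_comm (u := y) (v := x)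
    rcases hr with hr | hr
    · have e2 : G.dist z p ≤ G.dist z r + G.dist r p := hG.dist_triangle
      have e3 : G.dist p y ≤ G.dist p r + G.dist r y := hG.dist_triangle
      omega
    · have e2 : G.dist y p ≤ G.dist y r + G.dist r p := hG.dist_triangle
      have e3 : G.dist p x ≤ G.dist p r + G.dist r x := hG.dist_triangle
      omega
  simp only
  exact_mod_cast key

/-! ### Odd closed walks and walks in the direct product -/

/-- Walk to a nearby minimal cycle, once around it, and back the same way: the two trips contribute
an even length, so the total stays odd. The `2` added to `⌈K⌉₊` pays for the infimum and for
reaching a vertex of the cycle. -/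
theorem exists_odd_closed_walk (hG : G.Connected) {L : ℕ}
    (hL : ∀ (a : V) (C : G.Walk a a), IsMinimalCycle C → C.length ≤ L) {K : ℝ} {w : V}
    (h : Metric.infEDist (MetricGraph.vertex G w) G.minimalCyclePoints ≤ ENNReal.ofReal K) :
    ∃ c : G.Walk w w, Odd c.length ∧ c.length ≤ L + 2 * (⌈K⌉₊ + 2) := by
  classical
  have hinf : Metric.infEDist (MetricGraph.vertex G w) G.minimalCyclePoints <
      ENNReal.ofReal K + 1 :=
    h.trans_lt (ENNReal.lt_add_right ENNReal.ofReal_ne_top one_ne_zero)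
  obtain ⟨s, ⟨a, C, hC, hs⟩, hws⟩ := Metric.infEDist_lt_iff.1 hinf
  obtain ⟨v, hv, hsv⟩ : ∃ v ∈ C.support, EDist.edist s (MetricGraph.vertex G v) ≤ 1 := by
    rcases hs with ⟨v, hv, rfl⟩ | ⟨u, v, huv, hs⟩
    · exact ⟨v, C.mem_verts_toSubgraph.1 hv, by simp⟩
    · exact ⟨u, C.mem_verts_toSubgraph.1 huv.fst_mem, hs.edist_vertex_le_one⟩
  have h4 := (PseudoEMetricSpace.edist_triangle _ s _).trans (add_le_add hws.le hsv)
  rw [hG.edist_vertex_vertex] at h4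
  have h5 : ENNReal.ofReal K ≤ (⌈K⌉₊ : ℕ) := by
    rw [← ENNReal.ofReal_natCast]
    exact ENNReal.ofReal_le_ofReal (Nat.le_ceil K)
  have h6 : (G.dist w v : ℝ≥0∞) ≤ ((⌈K⌉₊ + 2 : ℕ) : ℝ≥0∞) := by
    refine h4.trans ?_
    push_cast
    rw [add_assoc, one_add_one_eq_two]
    gcongr
  have h7 : G.dist w v ≤ ⌈K⌉₊ + 2 := by exact_mod_cast h6
  obtain ⟨p, hp⟩ := hG.exists_walk_length_eq_dist w v
  have hlen : (p.append ((C.rotate v hv).append p.reverse)).length = C.length + 2 * p.length := by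
    simp only [Walk.length_append, Walk.length_reverse, Walk.length_rotate]
    ring
  refine ⟨p.append ((C.rotate v hv).append p.reverse), ?_, ?_⟩
  · rw [hlen]
    exact hC.2.1.add_even (even_two_mul _)
  · rw [hlen]
    have := hL a C hC
    omega

theorem exists_walk_directProduct_of_length_eq {u u' : V} {v v' : W} (p : G.Walk u u')
    (q : H.Walk v v') (h : p.length = q.length) :
    ∃ r : (G.directProduct H).Walk (u, v) (u', v'), r.length = p.length := by
  induction p generalizing v with
  | nil =>
    obtain rfl := Walk.eq_of_length_eq_zero (p := q) h.symm
    exact ⟨Walk.nil, rfl⟩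
  | cons hadj p ih =>
    cases q with
    | nil => simp at h
    | cons hadj' q =>
      obtain ⟨r, hr⟩ := ih q (by simpa using h)
      exact ⟨Walk.cons (show (G.directProduct H).Adj _ _ from ⟨hadj, hadj'⟩) r, by simp [hr]⟩

theorem Walk.exists_length_eq_add_two_mul {u v w : V} (p : G.Walk u v) (h : G.Adj u w) (k : ℕ) :
    ∃ q : G.Walk u v, q.length = p.length + 2 * k := by
  induction k with
  | zero => exact ⟨p, rfl⟩
  | succ k ih =>
    obtain ⟨q, hq⟩ := ih
    exact ⟨Walk.cons h (Walk.cons h.symm q), by simp [hq]; ring⟩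

/-- Walks of equal length pair up to a walk in the product. When the lengths agree in parity, the
shorter walk is first padded by backtracking along the given edge at its start. -/
theorem exists_walk_directProduct {u u' s : V} {v v' t : W} (hs : G.Adj u s) (ht : H.Adj v t)
    (p : G.Walk u u') (q : H.Walk v v') (h : Even (p.length + q.length)) :
    ∃ r : (G.directProduct H).Walk (u, v) (u', v'), r.length ≤ p.length + q.length := by
  rcases le_total p.length q.length with hle | hle
  · obtain ⟨k, hk⟩ : ∃ k, q.length = p.length + 2 * k := by
      obtain ⟨m, hm⟩ := h
      exact ⟨q.length - m, by omega⟩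
    obtain ⟨p', hp'⟩ := p.exists_length_eq_add_two_mul hs k
    obtain ⟨r, hr⟩ := exists_walk_directProduct_of_length_eq p' q (by omega)
    exact ⟨r, by omega⟩
  · obtain ⟨k, hk⟩ : ∃ k, p.length = q.length + 2 * k := by
      obtain ⟨m, hm⟩ := h
      exact ⟨p.length - m, by omega⟩
    obtain ⟨q', hq'⟩ := q.exists_length_eq_add_two_mul ht k
    obtain ⟨r, hr⟩ := exists_walk_directProduct_of_length_eq p q' (by omega)
    exact ⟨r, by omega⟩

/-- If the parities disagree, one prior tour of the odd closed walk `c` corrects them; `c` also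
supplies the edge at `u` needed for padding. -/
theorem exists_walk_directProduct_of_odd {u u' : V} {v v' t : W} (c : G.Walk u u)
    (hc : Odd c.length) (ht : H.Adj v t) (p : G.Walk u u') (q : H.Walk v v') :
    ∃ r : (G.directProduct H).Walk (u, v) (u', v'), r.length ≤ c.length + p.length + q.length := by
  have hs : G.Adj u c.snd := c.adj_snd (by
    intro hnil
    rw [Walk.length_eq_zero_iff.2 hnil] at hc
    simp at hc)
  by_cases h : Even (p.length + q.length)
  · obtain ⟨r, hr⟩ := exists_walk_directProduct hs ht p q h
    exact ⟨r, by omega⟩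
  · obtain ⟨r, hr⟩ := exists_walk_directProduct hs ht (c.append p) q (by
      rw [Walk.length_append]
      grind)
    rw [Walk.length_append] at hr
    exact ⟨r, hr⟩

theorem dist_fst_le_length {x y : V × W} (r : (G.directProduct H).Walk x y) :
    G.dist x.1 y.1 ≤ r.length := by
  let φ : G.directProduct H →g G := ⟨Prod.fst, fun h => h.1⟩
  have := G.dist_le (r.map φ)
  rwa [Walk.length_map] at this

/-! ### Passage between vertices and the metric graph, and the conclusion -/

theorem IsBoundedGraph.exists_dist_le (hG : G.Connected) (h : G.IsBoundedGraph) :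
    ∃ D : ℕ, ∀ u v, G.dist u v ≤ D := by
  obtain ⟨D, hD⟩ := ENNReal.exists_nat_gt h.ne
  refine ⟨D, fun u v => ?_⟩
  have := (Metric.edist_le_ediam_of_mem (Set.mem_univ (MetricGraph.vertex G u))
    (Set.mem_univ (MetricGraph.vertex G v))).trans hD.le
  rw [hG.edist_vertex_vertex] at this
  exact_mod_cast this

/-- A connected graph whose vertices satisfy the four-point condition is hyperbolic. -/
theorem IsHyperbolic.of_fourPointCondition (hG : G.Connected) {c : ℝ} (h0 : 0 ≤ c)
    (h : FourPointCondition (fun u v => (G.dist u v : ℝ)) c) : G.IsHyperbolic := by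
  choose f hf using fun x : MetricGraph G => x.exists_edist_vertex_le_one
  have hvert : ∀ u v, EDist.edist (MetricGraph.vertex G u) (MetricGraph.vertex G v) ≠ ⊤ := by
    intro u v
    rw [hG.edist_vertex_vertex]
    exact ENNReal.natCast_ne_top _
  have hx : ∀ x, EDist.edist x (MetricGraph.vertex G (f x)) ≠ ⊤ :=
    fun x => ((hf x).trans_lt ENNReal.one_lt_top).ne
  have hfin : ∀ x y : MetricGraph G, EDist.edist x y ≠ ⊤ := by
    intro x y
    refine ne_top_of_le_ne_top ?_
      (edist_triangle4 x (MetricGraph.vertex G (f x)) (MetricGraph.vertex G (f y)) y)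
    refine ENNReal.add_ne_top.2 ⟨ENNReal.add_ne_top.2 ⟨hx x, hvert _ _⟩, ?_⟩
    rw [PseudoEMetricSpace.edist_comm]
    exact hx y
  let _ : PseudoMetricSpace (MetricGraph G) := PseudoEMetricSpace.toPseudoMetricSpace hfin
  have hnear : ∀ x, Dist.dist x (MetricGraph.vertex G (f x)) ≤ 1 := by
    intro x
    rw [dist_edist]
    exact ENNReal.toReal_le_of_le_ofReal zero_le_one (by simpa using hf x)
  have hdist : ∀ u v, Dist.dist (MetricGraph.vertex G u) (MetricGraph.vertex G v) = G.dist u v := by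
    intro u v
    rw [dist_edist]
    have := congrArg ENNReal.toReal (hG.edist_vertex_vertex u v)
    simpa using this
  -- Replacing both points by vertices within distance one changes their distance by at most `2`.
  have h4 : FourPointCondition (Dist.dist : MetricGraph G → MetricGraph G → ℝ) (c + 4 * 2) := by
    refine h.of_abs_sub_le f fun x y => ?_
    rw [← hdist]
    have := dist_dist_dist_le x y (MetricGraph.vertex G (f x)) (MetricGraph.vertex G (f y))
    rw [Real.dist_eq] at this
    linarith [hnear x, hnear y]
  exact h4.isGromovHyperbolic (by linarith)

end SimpleGraph

theorem mainTheorem6 {V₁ V₂ : Type*} (G₁ : SimpleGraph V₁) (G₂ : SimpleGraph V₂)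
    (hconn₁ : G₁.Connected) (hconn₂ : G₂.Connected)
    (hG₁ : G₁.IsHyperbolic) (hnontrivial : Nontrivial V₂) (hG₂ : G₂.IsBoundedGraph)
    (K : ℝ) (hK : 0 < K)
    (hdense : ∀ w : V₁, Metric.infEDist (MetricGraph.vertex G₁ w)
      G₁.minimalCyclePoints ≤ ENNReal.ofReal K) :
    (G₁.directProduct G₂).IsHyperbolic := by
  obtain ⟨c, hc⟩ := hG₁.exists_fourPointCondition hconn₁
  obtain ⟨D, hD⟩ := hG₂.exists_dist_le hconn₂
  have hL : ∀ (a : V₁) (C : G₁.Walk a a), SimpleGraph.IsMinimalCycle C → C.length ≤ 2 * c + 10 :=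
    fun a C hC => hC.length_le hconn₁ hc
  -- The length bound for an odd closed walk at any vertex of `G₁`, plus the diameter bound of `G₂`.
  set M := 2 * c + 10 + 2 * (⌈K⌉₊ + 2) + D with hM
  have hwalk : ∀ x y : V₁ × V₂, ∃ r : (G₁.directProduct G₂).Walk x y,
      r.length ≤ G₁.dist x.1 y.1 + M := by
    rintro ⟨u, v⟩ ⟨u', v'⟩
    obtain ⟨o, ho, hol⟩ := SimpleGraph.exists_odd_closed_walk hconn₁ hL (hdense u)
    obtain ⟨p, hp⟩ := hconn₁.exists_walk_length_eq_dist u u'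
    obtain ⟨q, hq⟩ := hconn₂.exists_walk_length_eq_dist v v'
    obtain ⟨t, ht⟩ := hconn₂.preconnected.exists_adj_of_nontrivial v
    obtain ⟨r, hr⟩ := SimpleGraph.exists_walk_directProduct_of_odd o ho ht p q
    have := hD v v'
    exact ⟨r, by simp only; omega⟩
  have hne₁ := hconn₁.nonempty
  have hne₂ := hconn₂.nonempty
  have hconn : (G₁.directProduct G₂).Connected :=
    { preconnected := fun x y => ⟨(hwalk x y).choose⟩
      nonempty := inferInstance }
  refine SimpleGraph.IsHyperbolic.of_fourPointCondition hconn (c := c + 4 * M) (by positivity) ?_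
  -- The projection shortens distances by at most `M`, by `hwalk`, and never lengthens them, since
  -- walks project to walks.
  refine hc.of_abs_sub_le Prod.fst fun x y => ?_
  obtain ⟨r, hr⟩ := hwalk x y
  obtain ⟨s, hs⟩ := hconn.exists_walk_length_eq_dist x y
  have h1 := (G₁.directProduct G₂).dist_le r
  have h2 := SimpleGraph.dist_fst_le_length s
  have h3 : ((G₁.directProduct G₂).dist x y : ℝ) ≤ G₁.dist x.1 y.1 + M := by
    exact_mod_cast h1.trans hr
  have h4 : (G₁.dist x.1 y.1 : ℝ) ≤ (G₁.directProduct G₂).dist x y := by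
    exact_mod_cast hs ▸ h2
  rw [abs_le]
  constructor <;> linarith [(M.cast_nonneg : (0 : ℝ) ≤ M)]
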